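/- Let $\mathbb{D}=\{z\in\mathbb{C}:|z|<1\}$ and let $\varphi(z)=1+B_1z+B_2z^2+B_3z^3+B_4z^4+\cdots$ be analytic and univalent in $\mathbb{D}$ with $\operatorname{Re}\varphi>0$, $B_1>0$ and $B_2,B_3,B_4$ real. Let $\mathcal{S}^*_s(\varphi)$ be the class of functions $f$ analytic in $\mathbb{D}$ with $f(0)=0$, $f'(0)=1$, $f(z)\neq f(-z)$ for $z\in\mathbb{D}\setminus\{0\}$, and $$\frac{2zf'(z)}{f(z)-f(-z)}\prec\varphi(z),$$ that is, $\frac{2zf'(z)}{f(z)-f(-z)}=\varphi(\omega(z))$ in $\mathbb{D}$ for some analytic $\omega:\mathbb{D}\to\mathbb{D}$ with $\omega(0)=0$ (the quotient is given its limit value $1$ at $z=0$). Assume that (C1) $\;|B_1^3-2B_1B_2+2B_2^2|<|2B_1^2-B_1^3-2B_1B_2|$; (C2) $\;|B_1^3-B_1^2B_2+3B_2^2-3B_1B_3|<3\,|B_1^3-B_1^2+B_2^2|$; (C3) $\;|N|<2\,\big|\big((B_1-2)B_1+2B_2\big)\big(B_1(2B_1+B_2-3)+3B_3\big)\big(4B_1^3+6B_2^2-B_1^2(B_2+3)-3B_1B_3\big)\big|$,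 where $$\begin{aligned}N={}&B_1^7-B_1^6(8B_2+3)-6B_1^4\big(B_2(3B_2+2B_3+2)-6B_3+9B_4\big)+B_1^5\big(7B_2(B_2+4)-24B_3+18B_4\big)\\&+6B_1^3\big(B_2^3-2B_2^2+8B_2B_3-3B_3^2+6(B_2+1)B_4\big)\\&-6B_1B_2\big(3B_2^3-6B_3^2+B_2^2(4B_3-6)+6B_2(B_4-2B_3)\big)\\&+18B_2^2\big(-2B_3^2+B_2((B_2-2)B_2+2B_4)\big)\\&+B_1^2B_2\big(B_2(B_2(5B_2+6)-24B_3+18B_4)-36(2B_3+B_4)\big);\end{aligned}$$ (C4) $\;0<\dfrac{2B_1-B_1^2-2B_2}{2(B_1-B_2)}<1$. Then every $f(z)=z+a_2z^2+a_3z^3+\cdots$ in $\mathcal{S}^*_s(\varphi)$ satisfies $|a_5|\le B_1/4$. The bound is sharp: there is an analytic function $\tilde f$ in $\mathbb{D}$ with $\tilde f(0)=0$, $\tilde f'(0)=1$ and $$\frac{2z\tilde f'(z)}{\tilde f(z)-\tilde f(-z)}=\varphi(z^4)\qquad(z\in\mathbb{D}),$$ and every such $\tilde f$ belongs to $\mathcal{S}^*_s(\varphi)$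 and has $|a_5|=B_1/4$. -/

import Mathlib

/-- The open unit disk of the complex plane. -/
def unitDisk : Set ℂ := Metric.ball (0 : ℂ) 1

/-- The `n`-th Taylor coefficient of `f` at the origin. -/
noncomputable def taylorCoeff (f : ℂ → ℂ) (n : ℕ) : ℂ :=
  iteratedDeriv n f 0 / (n.factorial : ℂ)

/-- The class of holomorphic functions in the unit disk with `f 0 = 0` and `f' 0 = 1`. -/
structure IsNormalized (f : ℂ → ℂ) : Prop where
  holomorphic : DifferentiableOn ℂ f unitDisk
  map_zero : f 0 = 0
  deriv_zero : deriv f 0 = 1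

/-- Schwarz functions: holomorphic self-maps of the unit disk fixing the origin. -/
structure IsSchwarz (ω : ℂ → ℂ) : Prop where
  holomorphic : DifferentiableOn ℂ ω unitDisk
  mapsTo : Set.MapsTo ω unitDisk unitDisk
  map_zero : ω 0 = 0

/-- Subordination `g ≺ h` in the unit disk: `g = h ∘ ω` for some Schwarz function `ω`. -/
def Subordinate (g h : ℂ → ℂ) : Prop :=
  ∃ ω : ℂ → ℂ, IsSchwarz ω ∧ ∀ z ∈ unitDisk, g z = h (ω z)

/-- The quotient `2 z f'(z) / (f(z) - f(-z))`. For `f` with `f 0 = 0` and `f' 0 = 1` the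
singularity at the origin is removable, and the value there is the limit `1`. -/
noncomputable def symmetricQuotient (f : ℂ → ℂ) (z : ℂ) : ℂ :=
  if z = 0 then 1 else 2 * z * deriv f z / (f z - f (-z))

/-- The functions `φ`: holomorphic and univalent in the unit disk, with positive real part,
`φ 0 = 1` and `φ' 0` real and positive. -/
structure IsAdmissible (φ : ℂ → ℂ) : Prop where
  holomorphic : DifferentiableOn ℂ φ unitDisk
  univalent : Set.InjOn φ unitDisk
  re_pos : ∀ z ∈ unitDisk, 0 < (φ z).re
  map_zero : φ 0 = 1
  deriv_re_pos : 0 < (deriv φ 0).re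
  deriv_im : (deriv φ 0).im = 0

/-- The class of functions starlike with respect to symmetric points associated with `φ`. -/
structure IsSymmetricStarlike (φ f : ℂ → ℂ) : Prop where
  normalized : IsNormalized f
  /-- The quotient has no vanishing denominator off the origin. -/
  ne : ∀ z ∈ unitDisk, z ≠ 0 → f z ≠ f (-z)
  subordinate : Subordinate (symmetricQuotient f) φ

/-- First condition on the coefficients. -/
def ConditionC1 (B₁ B₂ : ℝ) : Prop :=
  |B₁ ^ 3 - 2 * B₁ * B₂ + 2 * B₂ ^ 2| < |2 * B₁ ^ 2 - B₁ ^ 3 - 2 * B₁ * B₂|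

/-- Second condition on the coefficients. -/
def ConditionC2 (B₁ B₂ B₃ : ℝ) : Prop :=
  |B₁ ^ 3 - B₁ ^ 2 * B₂ + 3 * B₂ ^ 2 - 3 * B₁ * B₃| < 3 * |B₁ ^ 3 - B₁ ^ 2 + B₂ ^ 2|

/-- Third condition on the coefficients. -/
def ConditionC3 (B₁ B₂ B₃ B₄ : ℝ) : Prop :=
  |B₁ ^ 7 - B₁ ^ 6 * (8 * B₂ + 3)
      - 6 * B₁ ^ 4 * (B₂ * (3 * B₂ + 2 * B₃ + 2) - 6 * B₃ + 9 * B₄)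
      + B₁ ^ 5 * (7 * B₂ * (B₂ + 4) - 24 * B₃ + 18 * B₄)
      + 6 * B₁ ^ 3 * (B₂ ^ 3 - 2 * B₂ ^ 2 + 8 * B₂ * B₃ - 3 * B₃ ^ 2 + 6 * (B₂ + 1) * B₄)
      - 6 * B₁ * B₂ * (3 * B₂ ^ 3 - 6 * B₃ ^ 2 + B₂ ^ 2 * (4 * B₃ - 6)
          + 6 * B₂ * (B₄ - 2 * B₃))
      + 18 * B₂ ^ 2 * (-2 * B₃ ^ 2 + B₂ * ((B₂ - 2) * B₂ + 2 * B₄))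
      + B₁ ^ 2 * B₂ * (B₂ * (B₂ * (5 * B₂ + 6) - 24 * B₃ + 18 * B₄) - 36 * (2 * B₃ + B₄))|
    < 2 * |((B₁ - 2) * B₁ + 2 * B₂) * (B₁ * (2 * B₁ + B₂ - 3) + 3 * B₃)
        * (4 * B₁ ^ 3 + 6 * B₂ ^ 2 - B₁ ^ 2 * (B₂ + 3) - 3 * B₁ * B₃)|

/-- Fourth condition on the coefficients. -/
def ConditionC4 (B₁ B₂ : ℝ) : Prop :=
  0 < (2 * B₁ - B₁ ^ 2 - 2 * B₂) / (2 * (B₁ - B₂)) ∧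
    (2 * B₁ - B₁ ^ 2 - 2 * B₂) / (2 * (B₁ - B₂)) < 1

/-!
Write `p = φ ∘ ω` with `ω` a Schwarz function, `ω(z) = c₁ z + c₂ z² + ⋯`. Comparing coefficients in
`2 z f'(z) = (f(z) - f(-z)) p(z)` gives `4 a₅ = p₄ + p₂² / 2`
(`four_mul_taylorCoeff_five`), a weighted homogeneous polynomial in `c₁, …, c₄` with coefficients
depending on `B₁, …, B₄`. It has to be bounded by `B₁`.

The bound comes from a family of functionals. If `W` maps the disk to itself, fixes `0`, and `V` is
bounded by `1` on the disk, then every coefficient of `K = W / (1 - W V)` is at most `1` in modulus: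
with `y = 1 + V K` one has `K = W y`, and since multiplication by a function bounded by `1` does not
increase truncated `ℓ²` norms of coefficients, the energy of `K` up to index `n + 1` exceeds its
energy up to index `n` by at most `1` (`IsContractive.norm_coeff_feedback_le_one`). This is applied
to `V = S ∘ W`, where `S` is built by the Schur algorithm from three real parameters
`α₀, α₁, α₂ ∈ (-1, 1)`, and to the function `W` for which `W / (1 - W)` is an average of
rotations of `ω / (1 - ω)`; the averaging multiplies the coefficients of index `1, 2, 3, 4`
by `s, s², s, 1` (`IsContractive.exists_rotation_average`). Averaging is legitimate because
`w ↦ w / (1 - w)` maps the disk onto a half-plane, which is convex.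

The fourth coefficient of `K` then depends on the four parameters `s, α₀, α₁, α₂`, as many as the
functional `4 a₅ / B₁` has free coefficients, and matching the two determines the parameters.
The four conditions say exactly that `|α₀|, |α₁|, |α₂| < 1` and `0 < s² < 1`
(`exists_schur_parameters`).

Contractivity is treated as a property of formal power series, so that Möbius transformations and
averages need no composition of holomorphic functions; holomorphic functions enter through
Parseval's identity only (`isContractive_taylorSeries`).

For sharpness, the equation with `ω(z) = z⁴` is solved by an odd function
`f(z) = z exp g(z)` (`exists_extremal`).
-/

open PowerSeries

/-! ### Contractive power series -/

/-- The squared `ℓ²` norm of the coefficients of `g` of index at most `n`. -/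
noncomputable def truncNormSq (n : ℕ) (g : ℂ⟦X⟧) : ℝ :=
  ∑ k ∈ Finset.range (n + 1), ‖coeff k g‖ ^ 2

/-- A power series is contractive if multiplication by it does not increase any truncated `ℓ²`
norm. By Parseval's identity the Taylor series of a holomorphic function bounded by `1` in the unit
disk has this property; the converse holds as well, so this is an algebraic form of
the Schur class. -/
def IsContractive (u : ℂ⟦X⟧) : Prop :=
  ∀ (g : ℂ⟦X⟧) (n : ℕ), truncNormSq n (u * g) ≤ truncNormSq n g

theorem truncNormSq_congr {n : ℕ} {g h : ℂ⟦X⟧} (H : ∀ k ≤ n, coeff k g = coeff k h) :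
    truncNormSq n g = truncNormSq n h := by
  refine Finset.sum_congr rfl fun k hk => ?_
  rw [H k (by simpa [Nat.lt_succ_iff] using hk)]

theorem truncNormSq_succ (n : ℕ) (g : ℂ⟦X⟧) :
    truncNormSq (n + 1) g = truncNormSq n g + ‖coeff (n + 1) g‖ ^ 2 :=
  Finset.sum_range_succ _ _

theorem IsContractive.mul {u v : ℂ⟦X⟧} (hu : IsContractive u) (hv : IsContractive v) :
    IsContractive (u * v) := fun g n => by
  rw [mul_assoc]
  exact (hu _ n).trans (hv g n)

theorem isContractive_C {c : ℂ} (hc : ‖c‖ ≤ 1) : IsContractive (C c) := fun g n => by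
  refine Finset.sum_le_sum fun k _ => ?_
  rw [coeff_C_mul, norm_mul]
  gcongr
  exact mul_le_of_le_one_left (norm_nonneg _) hc

theorem IsContractive.norm_constantCoeff_le {u : ℂ⟦X⟧} (hu : IsContractive u) :
    ‖constantCoeff u‖ ≤ 1 := by
  have h := hu 1 0
  simp [truncNormSq] at h
  exact h

/-- Möbius transformations of the disk with a real parameter preserve contractivity. -/
theorem IsContractive.exists_moebius {Z : ℂ⟦X⟧} (hZ : IsContractive Z) {α : ℝ} (hα : |α| < 1) :
    ∃ T : ℂ⟦X⟧, IsContractive T ∧ T * (1 + C (α : ℂ) * Z) = C (α : ℂ) + Z := by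
  have h0 : constantCoeff (1 + C (α : ℂ) * Z) ≠ 0 := by
    intro h
    have h1 : (α : ℂ) * constantCoeff Z = -1 := by
      have : (1 : ℂ) + α * constantCoeff Z = 0 := by simpa using h
      linear_combination this
    have h2 := congrArg norm h1
    rw [norm_mul, norm_neg, norm_one, Complex.norm_real, Real.norm_eq_abs] at h2
    nlinarith [hZ.norm_constantCoeff_le, norm_nonneg (constantCoeff Z), abs_nonneg α]
  refine ⟨(C (α : ℂ) + Z) * (1 + C (α : ℂ) * Z)⁻¹, fun g n => ?_, ?_⟩
  · set y := (1 + C (α : ℂ) * Z)⁻¹ * g with hy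
    have hg : g = y + C (α : ℂ) * (Z * y) := by
      have : (1 + C (α : ℂ) * Z) * y = g := by
        rw [hy, ← mul_assoc, PowerSeries.mul_inv_cancel _ h0, one_mul]
      rw [← this]; ring
    have hl : (C (α : ℂ) + Z) * (1 + C (α : ℂ) * Z)⁻¹ * g = C (α : ℂ) * y + Z * y := by
      rw [hy]; ring
    rw [hl]
    have hc := hZ y n
    -- `|y + αx|² - |αy + x|² = (1 - α²)(|y|² - |x|²)` for real `α`.
    have key : truncNormSq n g - truncNormSq n (C (α : ℂ) * y + Z * y)
        = (1 - α ^ 2) * (truncNormSq n y - truncNormSq n (Z * y)) := by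
      simp only [truncNormSq, ← Finset.sum_sub_distrib, Finset.mul_sum]
      refine Finset.sum_congr rfl fun k _ => ?_
      rw [hg]
      simp only [map_add, coeff_C_mul, ← Complex.normSq_eq_norm_sq, Complex.normSq_apply,
        Complex.add_re, Complex.add_im, Complex.re_ofReal_mul, Complex.im_ofReal_mul]
      ring
    have h1 : 0 ≤ 1 - α ^ 2 := by
      have := (sq_lt_one_iff_abs_lt_one α).2 hα
      linarith
    nlinarith [mul_nonneg h1 (sub_nonneg.2 hc)]
  · rw [mul_assoc, PowerSeries.inv_mul_cancel _ h0, mul_one]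

/-- A contractive series without constant term is `X` times a contractive series, so that
multiplication by it gains one index. -/
theorem IsContractive.truncNormSq_succ_mul_le {W : ℂ⟦X⟧} (hW : IsContractive W)
    (hW0 : constantCoeff W = 0) (g : ℂ⟦X⟧) (n : ℕ) :
    truncNormSq (n + 1) (W * g) ≤ truncNormSq n g := by
  set t : ℂ⟦X⟧ := ((trunc (n + 1) g : Polynomial ℂ) : ℂ⟦X⟧) with ht
  have hc : ∀ k, coeff k t = if k < n + 1 then coeff k g else 0 := fun k => by
    rw [ht, Polynomial.coeff_coe, coeff_trunc]
  have h1 : truncNormSq (n + 1) (W * g) = truncNormSq (n + 1) (W * t) := by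
    refine truncNormSq_congr fun k hk => ?_
    rw [coeff_mul, coeff_mul]
    refine Finset.sum_congr rfl fun ⟨i, j⟩ hij => ?_
    replace hij : i + j = k := Finset.HasAntidiagonal.mem_antidiagonal.1 hij
    rcases Nat.eq_zero_or_pos i with rfl | hi
    · simp [hW0]
    · simp only at hij ⊢
      rw [hc, if_pos (by omega)]
  have h2 : truncNormSq (n + 1) t = truncNormSq n g := by
    rw [truncNormSq_succ, hc, if_neg (by omega), norm_zero]
    simp only [ne_eq, OfNat.ofNat_ne_zero, not_false_eq_true, zero_pow, add_zero]
    exact truncNormSq_congr fun k hk => by rw [hc, if_pos (by omega)]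
  rw [h1, ← h2]
  exact hW t (n + 1)

/-- A coefficient bound for a feedback loop: with `y = 1 + V K` one has `K = W y`, so the energy
of `K` up to index `n + 1` is at most that of `y` up to index `n`, hence at most one plus that of
`K` up to index `n`. -/
theorem IsContractive.norm_coeff_feedback_le_one {W V K : ℂ⟦X⟧} (hW : IsContractive W)
    (hW0 : constantCoeff W = 0) (hV : IsContractive V) (hK : K * (1 - W * V) = W) (n : ℕ) :
    ‖coeff (n + 1) K‖ ≤ 1 := by
  have hK' : K = W * (1 + V * K) := by linear_combination hK
  have hK0 : constantCoeff K = 0 := by rw [hK', map_mul, hW0, zero_mul]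
  have h1 : truncNormSq (n + 1) K ≤ truncNormSq n (1 + V * K) := by
    nth_rewrite 1 [hK']
    exact hW.truncNormSq_succ_mul_le hW0 _ n
  have h2 : truncNormSq n (1 + V * K) = 1 + truncNormSq n (V * K) := by
    simp only [truncNormSq]
    rw [Finset.sum_range_succ', Finset.sum_range_succ' _ n]
    simp [coeff_one, hK0, add_comm]
  have h3 := hV K n
  have h4 := truncNormSq_succ n K
  have h5 : ‖coeff (n + 1) K‖ ^ 2 ≤ 1 := by linarith
  exact (sq_le_one_iff₀ (norm_nonneg _)).1 h5

/-! ### Averages over rotations -/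

/-- The truncated form of `Re Q ≥ -1/2`, positivity of the real part of `1 + 2 Q`. -/
def IsHalfPlane (Q : ℂ⟦X⟧) : Prop :=
  ∀ (g : ℂ⟦X⟧) (n : ℕ), 0 ≤ ∑ k ∈ Finset.range (n + 1),
    (‖coeff k g‖ ^ 2 + 2 * (coeff k (Q * g) * starRingEnd ℂ (coeff k g)).re)

/-- `w ↦ w / (1 - w)` maps the disk to the half-plane `Re > -1/2`. -/
theorem IsContractive.isHalfPlane {W x : ℂ⟦X⟧} (hW : IsContractive W)
    (hW0 : constantCoeff W = 0) (hx : x * (1 - W) = W) : IsHalfPlane x := fun g n => by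
  have h0 : constantCoeff (1 - W) ≠ 0 := by simp [hW0]
  set y := (1 - W)⁻¹ * g with hy
  have hg : g = y - W * y := by
    have : (1 - W) * y = g := by rw [hy, ← mul_assoc, PowerSeries.mul_inv_cancel _ h0, one_mul]
    rw [← this]; ring
  have hxg : x * g = W * y := by rw [hg]; linear_combination y * hx
  rw [hxg]
  have hc := hW y n
  have key : ∑ k ∈ Finset.range (n + 1),
      (‖coeff k g‖ ^ 2 + 2 * (coeff k (W * y) * starRingEnd ℂ (coeff k g)).re)
      = truncNormSq n y - truncNormSq n (W * y) := by
    simp only [truncNormSq, ← Finset.sum_sub_distrib]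
    refine Finset.sum_congr rfl fun k _ => ?_
    rw [hg]
    simp only [map_sub, ← Complex.normSq_eq_norm_sq, Complex.normSq_apply, Complex.sub_re,
      Complex.sub_im, Complex.mul_re, Complex.conj_re, Complex.conj_im]
    ring
  rw [key]
  linarith

/-- `q ↦ q / (1 + q)` maps the half-plane `Re > -1/2` to the disk. -/
theorem IsHalfPlane.isContractive {Q W : ℂ⟦X⟧} (hQ : IsHalfPlane Q)
    (hQ0 : constantCoeff Q = 0) (hW : W * (1 + Q) = Q) : IsContractive W := fun g n => by
  have h0 : constantCoeff (1 + Q) ≠ 0 := by simp [hQ0]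
  set y := (1 + Q)⁻¹ * g with hy
  have hg : g = y + Q * y := by
    have : (1 + Q) * y = g := by rw [hy, ← mul_assoc, PowerSeries.mul_inv_cancel _ h0, one_mul]
    rw [← this]; ring
  have hWg : W * g = Q * y := by rw [hg]; linear_combination y * hW
  rw [hWg]
  have key : truncNormSq n g - truncNormSq n (Q * y) = ∑ k ∈ Finset.range (n + 1),
      (‖coeff k y‖ ^ 2 + 2 * (coeff k (Q * y) * starRingEnd ℂ (coeff k y)).re) := by
    simp only [truncNormSq, ← Finset.sum_sub_distrib]
    refine Finset.sum_congr rfl fun k _ => ?_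
    rw [hg]
    simp only [map_add, ← Complex.normSq_eq_norm_sq, Complex.normSq_apply, Complex.add_re,
      Complex.add_im, Complex.mul_re, Complex.conj_re, Complex.conj_im]
    ring
  have := hQ y n
  linarith

theorem IsHalfPlane.rescale {Q : ℂ⟦X⟧} (hQ : IsHalfPlane Q) {ζ : ℂ} (hζ : ‖ζ‖ = 1) :
    IsHalfPlane (rescale ζ Q) := fun g n => by
  have hζ0 : ζ ≠ 0 := by rintro rfl; simp at hζ
  obtain ⟨g', rfl⟩ : ∃ g', g = PowerSeries.rescale ζ g' :=
    ⟨PowerSeries.rescale ζ⁻¹ g, by rw [rescale_rescale, inv_mul_cancel₀ hζ0]; simp⟩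
  have h := hQ g' n
  convert h using 2 with k _
  rw [← map_mul (PowerSeries.rescale ζ), coeff_rescale, coeff_rescale, norm_mul, norm_pow, hζ,
    one_pow, one_mul]
  have h1 : ζ ^ k * starRingEnd ℂ (ζ ^ k) = 1 := by
    rw [Complex.mul_conj, Complex.normSq_eq_norm_sq, norm_pow, hζ]; simp
  rw [map_mul (starRingEnd ℂ)]
  congr 3
  linear_combination (coeff k (Q * g') * starRingEnd ℂ (coeff k g')) * h1

theorem IsHalfPlane.sum {ι : Type*} {s : Finset ι} {m : ι → ℝ} {Q : ι → ℂ⟦X⟧}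
    (hQ : ∀ i ∈ s, IsHalfPlane (Q i)) (hm : ∀ i ∈ s, 0 ≤ m i) (hs : ∑ i ∈ s, m i = 1) :
    IsHalfPlane (∑ i ∈ s, C (m i : ℂ) * Q i) := fun g n => by
  have key : ∑ k ∈ Finset.range (n + 1), (‖coeff k g‖ ^ 2 +
        2 * (coeff k ((∑ i ∈ s, C (m i : ℂ) * Q i) * g) * starRingEnd ℂ (coeff k g)).re)
      = ∑ i ∈ s, m i * ∑ k ∈ Finset.range (n + 1),
        (‖coeff k g‖ ^ 2 + 2 * (coeff k (Q i * g) * starRingEnd ℂ (coeff k g)).re) := by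
    simp only [Finset.mul_sum]
    rw [Finset.sum_comm]
    refine Finset.sum_congr rfl fun k _ => ?_
    simp only [mul_add, Finset.sum_add_distrib, ← Finset.sum_mul, hs, one_mul]
    simp only [Finset.sum_mul, map_sum, Complex.re_sum, Finset.mul_sum, mul_assoc, coeff_C_mul,
      Complex.re_ofReal_mul]
    congr 1
    refine Finset.sum_congr rfl fun i _ => ?_
    ring
  rw [key]
  exact Finset.sum_nonneg fun i hi => mul_nonneg (hm i hi) (hQ i hi g n)

/-- For `0 ≤ s ≤ 1` the numbers `1, s, s², s` are the moments of a probability measure on the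
fourth roots of unity. Averaging `W / (1 - W)` over rotations with this measure multiplies its
coefficients of index `1, 2, 3, 4` by `s, s², s, 1`. -/
theorem IsContractive.exists_rotation_average {W x : ℂ⟦X⟧} (hW : IsContractive W)
    (hW0 : constantCoeff W = 0) (hx : x * (1 - W) = W) {s : ℝ} (h0 : 0 ≤ s) (h1 : s ≤ 1) :
    ∃ Q W' : ℂ⟦X⟧, IsContractive W' ∧ W' * (1 + Q) = Q ∧ coeff 0 Q = 0 ∧
      coeff 1 Q = s * coeff 1 x ∧ coeff 2 Q = s ^ 2 * coeff 2 x ∧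
      coeff 3 Q = s * coeff 3 x ∧ coeff 4 Q = coeff 4 x := by
  set m : Fin 4 → ℝ := ![(1 + s) ^ 2 / 4, (1 - s ^ 2) / 4, (1 - s) ^ 2 / 4, (1 - s ^ 2) / 4] with hm
  set Q : ℂ⟦X⟧ := ∑ i : Fin 4, C (m i : ℂ) * rescale (Complex.I ^ (i : ℕ)) x with hQ
  have hx0 : coeff 0 x = 0 := by
    have := congrArg constantCoeff hx
    simpa [hW0] using this
  have hmom : ∀ k, coeff k Q =
      (∑ i : Fin 4, (m i : ℂ) * (Complex.I ^ (i : ℕ)) ^ k) * coeff k x := by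
    intro k
    rw [hQ, map_sum, Finset.sum_mul]
    exact Finset.sum_congr rfl fun i _ => by rw [coeff_C_mul, coeff_rescale, mul_assoc]
  have hQ0 : coeff 0 Q = 0 := by rw [hmom, hx0, mul_zero]
  have hQ1 : constantCoeff (1 + Q) ≠ 0 := by
    rw [← coeff_zero_eq_constantCoeff_apply, map_add, hQ0]
    simp
  have hHP : IsHalfPlane Q := by
    refine IsHalfPlane.sum (fun i _ => (hW.isHalfPlane hW0 hx).rescale (by simp)) ?_ ?_
    · intro i _
      have : 0 ≤ 1 - s ^ 2 := by nlinarith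
      fin_cases i <;> simp [hm] <;> positivity
    · simp [hm, Fin.sum_univ_four]; ring
  have hI2 : Complex.I ^ 2 = -1 := Complex.I_sq
  have hI3 : Complex.I ^ 3 = -Complex.I := Complex.I_pow_three
  have hI4 : Complex.I ^ 4 = 1 := Complex.I_pow_four
  refine ⟨Q, Q * (1 + Q)⁻¹, ?_, ?_, hQ0, ?_, ?_, ?_, ?_⟩
  · refine hHP.isContractive (by simpa using hQ0) ?_
    rw [mul_assoc, PowerSeries.inv_mul_cancel _ hQ1, mul_one]
  · rw [mul_assoc, PowerSeries.inv_mul_cancel _ hQ1, mul_one]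
  all_goals
    rw [hmom]
    simp only [hm, Fin.sum_univ_four, Fin.val_zero, Fin.val_one, Fin.val_two, Matrix.cons_val,
      show ((3 : Fin 4) : ℕ) = 3 from rfl, hI2, hI3, hI4, pow_zero, pow_one, one_pow]
    push_cast
  · ring
  · linear_combination (1 - (s : ℂ) ^ 2) / 4 * coeff 2 x * hI2
  · linear_combination -(1 - (s : ℂ) ^ 2) / 4 * coeff 3 x * Complex.I * hI2
  · linear_combination (1 - (s : ℂ) ^ 2) / 4 * coeff 4 x * hI4

/-! ### Taylor series at the origin -/

/-- The Taylor series at the origin, as a formal power series. -/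
noncomputable def taylorSeries (f : ℂ → ℂ) : ℂ⟦X⟧ := PowerSeries.mk (taylorCoeff f)

@[simp] theorem coeff_taylorSeries (f : ℂ → ℂ) (n : ℕ) :
    coeff n (taylorSeries f) = taylorCoeff f n := coeff_mk _ _

theorem taylorCoeff_zero (f : ℂ → ℂ) : taylorCoeff f 0 = f 0 := by simp [taylorCoeff]

theorem taylorCoeff_one (f : ℂ → ℂ) : taylorCoeff f 1 = deriv f 0 := by simp [taylorCoeff]

@[simp] theorem constantCoeff_taylorSeries (f : ℂ → ℂ) :
    constantCoeff (taylorSeries f) = f 0 := by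
  rw [← coeff_zero_eq_constantCoeff_apply, coeff_taylorSeries, taylorCoeff_zero]

theorem taylorSeries_congr {f g : ℂ → ℂ} (h : f =ᶠ[nhds 0] g) :
    taylorSeries f = taylorSeries g := by
  ext n
  simp only [coeff_taylorSeries, taylorCoeff, h.iteratedDeriv_eq n]

theorem taylorSeries_mul {f g : ℂ → ℂ} (hf : AnalyticAt ℂ f 0) (hg : AnalyticAt ℂ g 0) :
    taylorSeries (fun z => f z * g z) = taylorSeries f * taylorSeries g := by
  ext n
  rw [show (fun z => f z * g z) = f * g from rfl]
  simp only [coeff_mul, coeff_taylorSeries, taylorCoeff,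
    iteratedDeriv_mul hf.contDiffAt hg.contDiffAt, Finset.sum_div,
    Finset.Nat.sum_antidiagonal_eq_sum_range_succ_mk, Nat.succ_eq_add_one]
  refine Finset.sum_congr rfl fun i hi => ?_
  rw [Nat.cast_choose _ (by grind)]
  field_simp [Nat.factorial_ne_zero]

theorem taylorSeries_add {f g : ℂ → ℂ} (hf : AnalyticAt ℂ f 0) (hg : AnalyticAt ℂ g 0) :
    taylorSeries (fun z => f z + g z) = taylorSeries f + taylorSeries g := by
  ext n
  simp only [map_add, coeff_taylorSeries, taylorCoeff,
    iteratedDeriv_fun_add hf.contDiffAt hg.contDiffAt, add_div]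

theorem taylorSeries_sub {f g : ℂ → ℂ} (hf : AnalyticAt ℂ f 0) (hg : AnalyticAt ℂ g 0) :
    taylorSeries (fun z => f z - g z) = taylorSeries f - taylorSeries g := by
  ext n
  simp only [map_sub, coeff_taylorSeries, taylorCoeff,
    iteratedDeriv_fun_sub hf.contDiffAt hg.contDiffAt, sub_div]

theorem taylorSeries_const (c : ℂ) : taylorSeries (fun _ => c) = C c := by
  ext n
  rw [coeff_taylorSeries, taylorCoeff, coeff_C, iteratedDeriv_const]
  split_ifs with h <;> simp [h]

theorem taylorSeries_id : taylorSeries (fun z => z) = X := by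
  ext n
  rw [coeff_taylorSeries, taylorCoeff, coeff_X, iteratedDeriv_fun_id]
  rcases n with _ | _ | n <;> simp

theorem taylorSeries_pow {f : ℂ → ℂ} (hf : AnalyticAt ℂ f 0) (n : ℕ) :
    taylorSeries (fun z => f z ^ n) = taylorSeries f ^ n := by
  induction n with
  | zero => simpa using taylorSeries_const 1
  | succ n ih =>
    simp only [pow_succ]
    rw [taylorSeries_mul (hf.fun_pow n) hf, ih]

theorem taylorCoeff_deriv (f : ℂ → ℂ) (n : ℕ) :
    taylorCoeff (deriv f) n = (n + 1) * taylorCoeff f (n + 1) := by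
  rw [taylorCoeff, taylorCoeff, iteratedDeriv_succ', Nat.factorial_succ]
  have := Nat.factorial_ne_zero n
  push_cast
  field_simp

theorem taylorCoeff_comp_neg (f : ℂ → ℂ) (n : ℕ) :
    taylorCoeff (fun z => f (-z)) n = (-1) ^ n * taylorCoeff f n := by
  rw [taylorCoeff, taylorCoeff, iteratedDeriv_comp_neg, neg_zero, smul_eq_mul, mul_div_assoc]

theorem analyticAt_dslope {φ : ℂ → ℂ} (hφ : AnalyticAt ℂ φ 0) : AnalyticAt ℂ (dslope φ 0) 0 := by
  obtain ⟨s, hs, hd⟩ := hφ.exists_mem_nhds_analyticOnNhd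
  exact ((Complex.differentiableOn_dslope hs).2 hd.differentiableOn).analyticAt hs

theorem eq_add_mul_dslope (φ : ℂ → ℂ) (w : ℂ) : φ w = φ 0 + w * dslope φ 0 w := by
  have := sub_smul_dslope φ 0 w
  rw [sub_zero, smul_eq_mul] at this
  rw [this]; ring

theorem taylorCoeff_dslope {φ : ℂ → ℂ} (hφ : AnalyticAt ℂ φ 0) (n : ℕ) :
    taylorCoeff (dslope φ 0) n = taylorCoeff φ (n + 1) := by
  have h : taylorSeries φ = C (φ 0) + X * taylorSeries (dslope φ 0) := by
    conv_lhs => rw [funext (eq_add_mul_dslope φ)]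
    have hid : AnalyticAt ℂ (fun z : ℂ => z) 0 := analyticAt_id
    rw [taylorSeries_add analyticAt_const (hid.fun_mul (analyticAt_dslope hφ)),
      taylorSeries_const, taylorSeries_mul hid (analyticAt_dslope hφ), taylorSeries_id]
  have := congrArg (coeff (n + 1)) h
  simpa [coeff_succ_X_mul, coeff_C] using this.symm

/-- The Taylor series of a composition, up to a multiple of `(taylorSeries ω) ^ N`. -/
theorem exists_taylorSeries_comp {ω : ℂ → ℂ} (hω : AnalyticAt ℂ ω 0) (hω0 : ω 0 = 0) (N : ℕ) :
    ∀ {φ : ℂ → ℂ}, AnalyticAt ℂ φ 0 → ∃ v : ℂ⟦X⟧, taylorSeries (fun z => φ (ω z)) =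
      ∑ k ∈ Finset.range N, C (taylorCoeff φ k) * taylorSeries ω ^ k + taylorSeries ω ^ N * v := by
  induction N with
  | zero => exact fun {φ} _ => ⟨taylorSeries (fun z => φ (ω z)), by simp⟩
  | succ N ih =>
    intro φ hφ
    have hd := analyticAt_dslope hφ
    obtain ⟨v, hv⟩ := ih hd
    have hdω : AnalyticAt ℂ (fun z => dslope φ 0 (ω z)) 0 :=
      AnalyticAt.fun_comp (by rwa [hω0]) hω
    refine ⟨v, ?_⟩
    conv_lhs => rw [funext fun z => eq_add_mul_dslope φ (ω z)]
    rw [taylorSeries_add analyticAt_const (hω.fun_mul hdω), taylorSeries_mul hω hdω, hv,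
      Finset.sum_range_succ', taylorSeries_const]
    simp only [taylorCoeff_dslope hφ, taylorCoeff_zero, pow_succ, pow_zero, mul_one, mul_add,
      Finset.mul_sum]
    rw [Finset.sum_congr rfl fun k _ => show taylorSeries ω * (C (taylorCoeff φ (k + 1)) *
      taylorSeries ω ^ k) =
        C (taylorCoeff φ (k + 1)) * (taylorSeries ω ^ k * taylorSeries ω) by ring]
    ring

/-! ### Bounded holomorphic functions have contractive Taylor series -/

theorem truncNormSq_le_circleAverage (p : Polynomial ℂ) (n : ℕ) :
    truncNormSq n p ≤ Real.circleAverage (fun ζ => ‖p.eval ζ‖ ^ 2) 0 1 := by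
  rw [← Polynomial.sum_sq_norm_coeff_eq_circleAverage]
  simp only [truncNormSq, Polynomial.coeff_coe]
  rw [← Finset.sum_subset (Finset.inter_subset_right (s₁ := p.support))]
  · exact Finset.sum_le_sum_of_subset_of_nonneg Finset.inter_subset_left
      fun _ _ _ => by positivity
  · intro k hk hk'
    have : p.coeff k = 0 := by
      by_contra h
      exact hk' (Finset.mem_inter.2 ⟨Polynomial.mem_support_iff.2 h, hk⟩)
    simp [this]

theorem circleAverage_le_truncNormSq (g : ℂ⟦X⟧) (n : ℕ) :
    Real.circleAverage (fun ζ => ‖(trunc (n + 1) g).eval ζ‖ ^ 2) 0 1 ≤ truncNormSq n g := by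
  rw [← Polynomial.sum_sq_norm_coeff_eq_circleAverage]
  have h : ∀ k ∈ (trunc (n + 1) g).support, k ∈ Finset.range (n + 1) := fun k hk => by
    by_contra hk'
    rw [Polynomial.mem_support_iff, coeff_trunc, if_neg (by simpa using hk')] at hk
    exact hk rfl
  refine (Finset.sum_congr rfl fun k hk => ?_).trans_le
    (Finset.sum_le_sum_of_subset_of_nonneg h fun _ _ _ => by positivity)
  rw [coeff_trunc, if_pos (by simpa using h k hk)]

/-- Partial sums of the Taylor series of a function bounded by `1` are bounded by `1 + ε` on
smaller disks. -/
theorem exists_forall_norm_sum_taylor_le {ω : ℂ → ℂ} (hω : DifferentiableOn ℂ ω unitDisk)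
    (hb : ∀ z ∈ unitDisk, ‖ω z‖ ≤ 1) {r : ℝ} (hr0 : 0 ≤ r) (hr : r < 1) {ε : ℝ} (hε : 0 < ε) :
    ∃ N₀, ∀ N ≥ N₀, ∀ z : ℂ, ‖z‖ ≤ r →
      ‖∑ k ∈ Finset.range N, taylorCoeff ω k * z ^ k‖ ≤ 1 + ε := by
  have hs : ∀ z ∈ unitDisk, HasSum (fun k => taylorCoeff ω k * z ^ k) (ω z) := fun z hz => by
    refine (Complex.hasSum_taylorSeries_on_ball hω hz).congr_fun fun k => ?_
    rw [taylorCoeff, sub_zero, smul_eq_mul, smul_eq_mul]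
    ring
  have hr' : (r : ℂ) ∈ unitDisk := by simpa [unitDisk, abs_of_nonneg hr0] using hr
  have hu : Summable fun k => ‖taylorCoeff ω k * (r : ℂ) ^ k‖ := (hs _ hr').summable.norm
  have ht := tendstoUniformlyOn_tsum_nat (f := fun k (z : ℂ) => taylorCoeff ω k * z ^ k)
    (s := {z | ‖z‖ ≤ r}) hu (fun k z hz => by
      simp only [norm_mul, norm_pow, Complex.norm_real, Real.norm_eq_abs, abs_of_nonneg hr0]
      gcongr
      exact hz)
  obtain ⟨N₀, hN⟩ := Filter.eventually_atTop.1 (Metric.tendstoUniformlyOn_iff.1 ht ε hε)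
  refine ⟨N₀, fun N h z hz => ?_⟩
  have hz' : z ∈ unitDisk := by simpa [unitDisk] using hz.trans_lt hr
  have h1 := hN N h z hz
  rw [(hs z hz').tsum_eq, dist_eq_norm, norm_sub_rev] at h1
  have h2 := norm_le_norm_add_norm_sub' (∑ k ∈ Finset.range N, taylorCoeff ω k * z ^ k) (ω z)
  have h3 := hb z hz'
  linarith

theorem isContractive_rescale_taylorSeries {ω : ℂ → ℂ} (hω : DifferentiableOn ℂ ω unitDisk)
    (hb : ∀ z ∈ unitDisk, ‖ω z‖ ≤ 1) {r : ℝ} (hr0 : 0 ≤ r) (hr : r < 1) :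
    IsContractive (rescale (r : ℂ) (taylorSeries ω)) := fun g n => by
  have hmain : ∀ ε : ℝ, 0 < ε → truncNormSq n (rescale (r : ℂ) (taylorSeries ω) * g) ≤
      (1 + ε) ^ 2 * truncNormSq n g := by
    intro ε hε
    obtain ⟨N₀, hN₀⟩ := exists_forall_norm_sum_taylor_le hω hb hr0 hr hε
    set N := max N₀ (n + 1) with hN
    set p := trunc N (rescale (r : ℂ) (taylorSeries ω)) with hp
    set G := trunc (n + 1) g with hG
    have hpe : ∀ ζ : ℂ, ‖ζ‖ = 1 → ‖p.eval ζ‖ ≤ 1 + ε := fun ζ hζ => by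
      have := hN₀ N (le_max_left _ _) (r * ζ) (by simp [hζ, abs_of_nonneg hr0])
      convert this using 2
      rw [hp, Polynomial.eval, eval₂_trunc_eq_sum_range]
      refine Finset.sum_congr rfl fun k _ => ?_
      rw [RingHom.id_apply, coeff_rescale, coeff_taylorSeries, mul_pow]; ring
    have h1 : truncNormSq n (rescale (r : ℂ) (taylorSeries ω) * g) =
        truncNormSq n ((p * G : Polynomial ℂ) : ℂ⟦X⟧) := by
      refine truncNormSq_congr fun k hk => ?_
      rw [Polynomial.coe_mul, coeff_mul, coeff_mul]
      refine Finset.sum_congr rfl fun ⟨i, j⟩ hij => ?_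
      replace hij : i + j = k := Finset.HasAntidiagonal.mem_antidiagonal.1 hij
      have : n + 1 ≤ N := le_max_right _ _
      simp only [Polynomial.coeff_coe, hp, hG, coeff_trunc]
      rw [if_pos (by omega), if_pos (by omega)]
    have hint : ∀ (c : ℝ) (q : Polynomial ℂ),
        CircleIntegrable (fun ζ => c * ‖q.eval ζ‖ ^ 2) 0 1 := fun c q =>
      ContinuousOn.circleIntegrable zero_le_one (by fun_prop)
    rw [h1]
    calc _ ≤ Real.circleAverage (fun ζ => 1 * ‖(p * G).eval ζ‖ ^ 2) 0 1 := by
            simpa using truncNormSq_le_circleAverage (p * G) n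
      _ ≤ Real.circleAverage (fun ζ => (1 + ε) ^ 2 * ‖G.eval ζ‖ ^ 2) 0 1 := by
            refine Real.circleAverage_mono (hint _ _) (hint _ _) fun ζ hζ => ?_
            have hζ1 : ‖ζ‖ = 1 := by simpa using hζ
            rw [Polynomial.eval_mul, norm_mul, mul_pow, one_mul]
            gcongr
            exact hpe ζ hζ1
      _ = (1 + ε) ^ 2 * Real.circleAverage (fun ζ => ‖G.eval ζ‖ ^ 2) 0 1 := by
            exact Real.circleAverage_fun_smul (𝕜 := ℝ) (E := ℝ)
      _ ≤ _ := by
            gcongr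
            exact circleAverage_le_truncNormSq g n
  have ht : Filter.Tendsto (fun ε : ℝ => (1 + ε) ^ 2 * truncNormSq n g) (nhdsWithin 0 (Set.Ioi 0))
      (nhds ((1 + 0) ^ 2 * truncNormSq n g)) :=
    ((by fun_prop : Continuous fun ε : ℝ => (1 + ε) ^ 2 * truncNormSq n g).tendsto 0).mono_left
      nhdsWithin_le_nhds
  rw [add_zero, one_pow, one_mul] at ht
  exact ge_of_tendsto ht (Filter.eventually_of_mem self_mem_nhdsWithin fun ε hε => hmain ε hε)

/-- Multiplication by a holomorphic function bounded by `1` on the disk is a contraction of the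
Hardy space, also after truncation. -/
theorem isContractive_taylorSeries {ω : ℂ → ℂ} (hω : DifferentiableOn ℂ ω unitDisk)
    (hb : ∀ z ∈ unitDisk, ‖ω z‖ ≤ 1) : IsContractive (taylorSeries ω) := fun g n => by
  have hc : Continuous fun r : ℝ => truncNormSq n (rescale (r : ℂ) (taylorSeries ω) * g) := by
    simp only [truncNormSq, coeff_mul, coeff_rescale]
    fun_prop
  have ht := (hc.tendsto 1).mono_left (nhdsWithin_le_nhds (s := Set.Iio 1))
  simp only [Complex.ofReal_one, rescale_one, RingHom.id_apply] at ht
  refine le_of_tendsto ht ?_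
  filter_upwards [Ioo_mem_nhdsLT (zero_lt_one' ℝ)] with r hr
  exact isContractive_rescale_taylorSeries hω hb hr.1.le hr.2 g n

/-! ### A family of coefficient functionals -/

theorem coeff_zero_mul_eq (f g : ℂ⟦X⟧) : coeff 0 (f * g) = coeff 0 f * coeff 0 g := by simp

theorem coeff_one_mul_eq (f g : ℂ⟦X⟧) : coeff 1 (f * g) =
    coeff 0 f * coeff 1 g + coeff 1 f * coeff 0 g := by
  simp only [coeff_mul, Finset.Nat.sum_antidiagonal_eq_sum_range_succ_mk, Finset.sum_range_succ,
    Finset.sum_range_zero, zero_add, Nat.succ_eq_add_one, Nat.reduceAdd, Nat.sub_zero,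
    Nat.sub_self]

theorem coeff_two_mul_eq (f g : ℂ⟦X⟧) : coeff 2 (f * g) =
    coeff 0 f * coeff 2 g + coeff 1 f * coeff 1 g + coeff 2 f * coeff 0 g := by
  simp only [coeff_mul, Finset.Nat.sum_antidiagonal_eq_sum_range_succ_mk, Finset.sum_range_succ,
    Finset.sum_range_zero, zero_add, Nat.succ_eq_add_one, Nat.reduceAdd, Nat.reduceSub,
    Nat.sub_zero, Nat.sub_self]

theorem coeff_three_mul_eq (f g : ℂ⟦X⟧) : coeff 3 (f * g) =
    coeff 0 f * coeff 3 g + coeff 1 f * coeff 2 g + coeff 2 f * coeff 1 g +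
      coeff 3 f * coeff 0 g := by
  simp only [coeff_mul, Finset.Nat.sum_antidiagonal_eq_sum_range_succ_mk, Finset.sum_range_succ,
    Finset.sum_range_zero, zero_add, Nat.succ_eq_add_one, Nat.reduceAdd, Nat.reduceSub,
    Nat.sub_zero, Nat.sub_self]

theorem coeff_four_mul_eq (f g : ℂ⟦X⟧) : coeff 4 (f * g) =
    coeff 0 f * coeff 4 g + coeff 1 f * coeff 3 g + coeff 2 f * coeff 2 g +
      coeff 3 f * coeff 1 g + coeff 4 f * coeff 0 g := by
  simp only [coeff_mul, Finset.Nat.sum_antidiagonal_eq_sum_range_succ_mk, Finset.sum_range_succ,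
    Finset.sum_range_zero, zero_add, Nat.succ_eq_add_one, Nat.reduceAdd, Nat.reduceSub,
    Nat.sub_zero, Nat.sub_self]

theorem coeff_five_mul_eq (f g : ℂ⟦X⟧) : coeff 5 (f * g) =
    coeff 0 f * coeff 5 g + coeff 1 f * coeff 4 g + coeff 2 f * coeff 3 g +
      coeff 3 f * coeff 2 g + coeff 4 f * coeff 1 g + coeff 5 f * coeff 0 g := by
  simp only [coeff_mul, Finset.Nat.sum_antidiagonal_eq_sum_range_succ_mk, Finset.sum_range_succ,
    Finset.sum_range_zero, zero_add, Nat.succ_eq_add_one, Nat.reduceAdd, Nat.reduceSub,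
    Nat.sub_zero, Nat.sub_self]

/-- The fourth coefficient of `W / (1 - W V)`, where
`V = (α₀ + W T) / (1 + α₀ W T)` and `T = (α₁ + α₂ W) / (1 + α₁ α₂ W)` are given by the Schur
algorithm with parameters `α₀, α₁, α₂`. -/
theorem IsContractive.norm_schur_functional_le {W : ℂ⟦X⟧} (hW : IsContractive W)
    (hW0 : constantCoeff W = 0) {α₀ α₁ α₂ : ℝ} (h0 : |α₀| < 1) (h1 : |α₁| < 1) (h2 : |α₂| < 1)
    {E₂ E₃ : ℝ} (hE₂ : E₂ = (1 - α₀ ^ 2) * α₁ + α₀ ^ 2)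
    (hE₃ : E₃ = (1 - α₀ ^ 2) * (α₂ * (1 - α₁ ^ 2) - α₀ * α₁ ^ 2)
      + 2 * α₀ * ((1 - α₀ ^ 2) * α₁) + α₀ ^ 3) :
    ‖coeff 4 W + α₀ * (2 * coeff 1 W * coeff 3 W + coeff 2 W ^ 2)
      + 3 * E₂ * coeff 1 W ^ 2 * coeff 2 W + E₃ * coeff 1 W ^ 4‖ ≤ 1 := by
  have hα₂ : IsContractive (C (α₂ : ℂ)) := isContractive_C (by simpa using h2.le)
  obtain ⟨T, hT, hTe⟩ := (hα₂.mul hW).exists_moebius h1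
  obtain ⟨V, hV, hVe⟩ := (hW.mul hT).exists_moebius h0
  have hc : constantCoeff (1 - W * V) ≠ 0 := by simp [hW0]
  set K := W * (1 - W * V)⁻¹ with hK
  have hKe : K * (1 - W * V) = W := by
    rw [hK, mul_assoc, PowerSeries.inv_mul_cancel _ hc, mul_one]
  have hle := hW.norm_coeff_feedback_le_one hW0 hV hKe 3
  have w0 : coeff 0 W = 0 := by simpa using hW0
  have hT' : T = C (α₁ : ℂ) + C (α₂ : ℂ) * W - C (α₁ : ℂ) * (C (α₂ : ℂ) * (W * T)) := by
    linear_combination hTe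
  have hV' : V = C (α₀ : ℂ) + W * T - C (α₀ : ℂ) * (W * (T * V)) := by linear_combination hVe
  have hK' : K = W + W * (V * K) := by linear_combination hKe
  have hC1 : ∀ c : ℂ, coeff 1 (C c) = 0 := fun c => by simp
  have hC2 : ∀ c : ℂ, coeff 2 (C c) = 0 := fun c => by simp
  have hC0 : ∀ c : ℂ, coeff 0 (C c) = c := fun c => by simp
  have t0 : coeff 0 T = α₁ := by
    rw [hT']
    simp only [map_add, map_sub, coeff_C_mul, coeff_zero_mul_eq, hC0, w0]
    ring
  have t1 : coeff 1 T = α₂ * (1 - α₁ ^ 2) * coeff 1 W := by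
    rw [hT']
    simp only [map_add, map_sub, coeff_C_mul, coeff_one_mul_eq, hC1, w0, t0]
    ring
  have v0 : coeff 0 V = α₀ := by
    rw [hV']
    simp only [map_add, map_sub, coeff_C_mul, coeff_zero_mul_eq, hC0, w0]
    ring
  have v1 : coeff 1 V = (1 - α₀ ^ 2) * α₁ * coeff 1 W := by
    rw [hV']
    simp only [map_add, map_sub, coeff_C_mul, coeff_one_mul_eq, coeff_zero_mul_eq, hC1, w0, t0, v0]
    ring
  have v2 : coeff 2 V = (1 - α₀ ^ 2) * α₁ * coeff 2 W +
      (1 - α₀ ^ 2) * (α₂ * (1 - α₁ ^ 2) - α₀ * α₁ ^ 2) * coeff 1 W ^ 2 := by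
    rw [hV']
    simp only [map_add, map_sub, coeff_C_mul, coeff_two_mul_eq, coeff_one_mul_eq,
      coeff_zero_mul_eq, hC2, w0, t0, t1, v0, v1]
    ring
  have k0 : coeff 0 K = 0 := by
    rw [hK']
    simp only [map_add, coeff_zero_mul_eq, w0]
    ring
  have k1 : coeff 1 K = coeff 1 W := by
    rw [hK']
    simp only [map_add, coeff_one_mul_eq, coeff_zero_mul_eq, w0, k0]
    ring
  have k2 : coeff 2 K = coeff 2 W + α₀ * coeff 1 W ^ 2 := by
    rw [hK']
    simp only [map_add, coeff_two_mul_eq, coeff_one_mul_eq, coeff_zero_mul_eq, w0, k0, k1, v0]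
    ring
  have k3 : coeff 3 K = coeff 3 W + 2 * α₀ * coeff 1 W * coeff 2 W + E₂ * coeff 1 W ^ 3 := by
    rw [hK', hE₂]
    simp only [map_add, coeff_three_mul_eq, coeff_two_mul_eq, coeff_one_mul_eq, coeff_zero_mul_eq,
      w0, k0, k1, k2, v0, v1]
    push_cast
    ring
  have k4 : coeff 4 K = coeff 4 W + α₀ * (2 * coeff 1 W * coeff 3 W + coeff 2 W ^ 2)
      + 3 * E₂ * coeff 1 W ^ 2 * coeff 2 W + E₃ * coeff 1 W ^ 4 := by
    rw [hK', hE₃]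
    simp only [map_add, coeff_four_mul_eq, coeff_three_mul_eq, coeff_two_mul_eq, coeff_one_mul_eq,
      coeff_zero_mul_eq, w0, k0, k1, k2, k3, v0, v1, v2, hE₂]
    push_cast
    ring
  rwa [← k4]

/-- The bound of `IsContractive.norm_schur_functional_le` for the average of `W` over rotations
(with moments `s, s², s`), expressed through the coefficients of `x = W / (1 - W)`. -/
theorem IsContractive.norm_averaged_functional_le {W x : ℂ⟦X⟧} (hW : IsContractive W)
    (hW0 : constantCoeff W = 0) (hx : x * (1 - W) = W) {s α₀ α₁ α₂ : ℝ} (hs0 : 0 ≤ s)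
    (hs1 : s ≤ 1) (h0 : |α₀| < 1) (h1 : |α₁| < 1) (h2 : |α₂| < 1)
    {E₂ E₃ : ℝ} (hE₂ : E₂ = (1 - α₀ ^ 2) * α₁ + α₀ ^ 2)
    (hE₃ : E₃ = (1 - α₀ ^ 2) * (α₂ * (1 - α₁ ^ 2) - α₀ * α₁ ^ 2)
      + 2 * α₀ * ((1 - α₀ ^ 2) * α₁) + α₀ ^ 3) :
    ‖coeff 4 x + (α₀ - 1) * (2 * s ^ 2 * coeff 1 x * coeff 3 x + s ^ 4 * coeff 2 x ^ 2)
      + 3 * s ^ 4 * (1 - 2 * α₀ + E₂) * coeff 1 x ^ 2 * coeff 2 x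
      + s ^ 4 * (-1 + 3 * α₀ - 3 * E₂ + E₃) * coeff 1 x ^ 4‖ ≤ 1 := by
  obtain ⟨Q, W', hW', hQ, q0, q1, q2, q3, q4⟩ := hW.exists_rotation_average hW0 hx hs0 hs1
  have hQ' : W' = Q - W' * Q := by linear_combination hQ
  have w0 : coeff 0 W' = 0 := by
    rw [hQ']
    simp only [map_sub, coeff_zero_mul_eq, q0]
    ring
  have w1 : coeff 1 W' = coeff 1 Q := by
    rw [hQ']
    simp only [map_sub, coeff_one_mul_eq, q0, w0]
    ring
  have w2 : coeff 2 W' = coeff 2 Q - coeff 1 Q ^ 2 := by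
    rw [hQ']
    simp only [map_sub, coeff_two_mul_eq, q0, w0, w1]
    ring
  have w3 : coeff 3 W' = coeff 3 Q - 2 * coeff 1 Q * coeff 2 Q + coeff 1 Q ^ 3 := by
    rw [hQ']
    simp only [map_sub, coeff_three_mul_eq, q0, w0, w1, w2]
    ring
  have w4 : coeff 4 W' = coeff 4 Q - 2 * coeff 1 Q * coeff 3 Q - coeff 2 Q ^ 2
      + 3 * coeff 1 Q ^ 2 * coeff 2 Q - coeff 1 Q ^ 4 := by
    rw [hQ']
    simp only [map_sub, coeff_four_mul_eq, q0, w0, w1, w2, w3]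
    ring
  have h := hW'.norm_schur_functional_le (by simpa using w0) h0 h1 h2 hE₂ hE₃
  convert h using 2
  rw [w1, w2, w3, w4, q1, q2, q3, q4]
  ring

/-- The coefficients of `W / (1 - W)` up to index `4`. -/
theorem coeff_geometric {W x : ℂ⟦X⟧} (hW0 : constantCoeff W = 0) (hx : x * (1 - W) = W) :
    coeff 1 x = coeff 1 W ∧ coeff 2 x = coeff 2 W + coeff 1 W ^ 2 ∧
    coeff 3 x = coeff 3 W + 2 * coeff 1 W * coeff 2 W + coeff 1 W ^ 3 ∧
    coeff 4 x = coeff 4 W + 2 * coeff 1 W * coeff 3 W + coeff 2 W ^ 2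
      + 3 * coeff 1 W ^ 2 * coeff 2 W + coeff 1 W ^ 4 := by
  have hx' : x = W + x * W := by linear_combination hx
  have w0 : coeff 0 W = 0 := by simpa using hW0
  have x0 : coeff 0 x = 0 := by
    rw [hx']
    simp only [map_add, coeff_zero_mul_eq, w0]
    ring
  have x1 : coeff 1 x = coeff 1 W := by
    rw [hx']
    simp only [map_add, coeff_one_mul_eq, w0, x0]
    ring
  have x2 : coeff 2 x = coeff 2 W + coeff 1 W ^ 2 := by
    rw [hx']
    simp only [map_add, coeff_two_mul_eq, w0, x0, x1]
    ring
  have x3 : coeff 3 x = coeff 3 W + 2 * coeff 1 W * coeff 2 W + coeff 1 W ^ 3 := by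
    rw [hx']
    simp only [map_add, coeff_three_mul_eq, w0, x0, x1, x2]
    ring
  refine ⟨x1, x2, x3, ?_⟩
  rw [hx']
  simp only [map_add, coeff_four_mul_eq, w0, x0, x1, x2, x3]
  ring

/-- The choice of parameters: `s² = a` is the quotient in the fourth condition, and `-α₀, α₁, -α₂`
are the quotients of the two sides of the first three conditions. The last four identities express
that the functional built from these parameters is the fifth coefficient up to normalization. -/
theorem exists_schur_parameters {B₁ B₂ B₃ B₄ : ℝ} (hB : 0 < B₁)
    (hC1 : ConditionC1 B₁ B₂) (hC2 : ConditionC2 B₁ B₂ B₃)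
    (hC3 : ConditionC3 B₁ B₂ B₃ B₄) (hC4 : ConditionC4 B₁ B₂) :
    ∃ s α₀ α₁ α₂ E₂ E₃ : ℝ, 0 ≤ s ∧ s ≤ 1 ∧ |α₀| < 1 ∧ |α₁| < 1 ∧ |α₂| < 1 ∧
      E₂ = (1 - α₀ ^ 2) * α₁ + α₀ ^ 2 ∧
      E₃ = (1 - α₀ ^ 2) * (α₂ * (1 - α₁ ^ 2) - α₀ * α₁ ^ 2)
        + 2 * α₀ * ((1 - α₀ ^ 2) * α₁) + α₀ ^ 3 ∧
      B₁ * (1 + s ^ 2 * (α₀ - 1)) = B₂ ∧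
      B₁ * (1 + s ^ 4 * (α₀ - 1)) = B₂ + B₁ ^ 2 / 2 ∧
      B₁ * (3 + (4 * s ^ 2 + 2 * s ^ 4) * (α₀ - 1) + 3 * s ^ 4 * (1 - 2 * α₀ + E₂))
        = 3 * B₃ + B₁ * B₂ ∧
      B₁ * (1 + (2 * s ^ 2 + s ^ 4) * (α₀ - 1) + 3 * s ^ 4 * (1 - 2 * α₀ + E₂)
        + s ^ 4 * (-1 + 3 * α₀ - 3 * E₂ + E₃)) = B₄ + B₂ ^ 2 / 2 := by
  obtain ⟨ha0, ha1⟩ := hC4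
  unfold ConditionC1 at hC1
  unfold ConditionC2 at hC2
  unfold ConditionC3 at hC3
  obtain ⟨u, hu⟩ : ∃ u, u = B₁ - B₂ := ⟨_, rfl⟩
  obtain ⟨d, hd⟩ : ∃ d, d = 2 * B₁ - B₁ ^ 2 - 2 * B₂ := ⟨_, rfl⟩
  obtain ⟨D, hD⟩ : ∃ D, D = B₁ ^ 3 - B₁ ^ 2 + B₂ ^ 2 := ⟨_, rfl⟩
  obtain ⟨P, hP⟩ : ∃ P, P = B₁ * (2 * B₁ + B₂ - 3) + 3 * B₃ := ⟨_, rfl⟩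
  obtain ⟨R, hR⟩ : ∃ R, R = 4 * B₁ ^ 3 + 6 * B₂ ^ 2 - B₁ ^ 2 * (B₂ + 3) - 3 * B₁ * B₃ := ⟨_, rfl⟩
  rw [show 2 * B₁ ^ 2 - B₁ ^ 3 - 2 * B₁ * B₂ = B₁ * d by rw [hd]; ring] at hC1
  rw [← hD, ← abs_of_pos (zero_lt_three' ℝ), ← abs_mul, abs_of_pos (zero_lt_three' ℝ)] at hC2
  rw [← hP, ← hR, show (B₁ - 2) * B₁ + 2 * B₂ = -d by rw [hd]; ring] at hC3
  rw [show 2 * |-d * P * R| = |2 * d * P * R| by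
    rw [neg_mul, neg_mul, abs_neg, mul_assoc 2, mul_assoc 2, abs_mul 2, abs_two]] at hC3
  rw [← hd, ← hu] at ha0 ha1
  obtain ⟨N₀, hN₀⟩ : ∃ N, N = B₁ ^ 3 - 2 * B₁ * B₂ + 2 * B₂ ^ 2 := ⟨_, rfl⟩
  obtain ⟨N₁, hN₁⟩ : ∃ N, N = B₁ ^ 3 - B₁ ^ 2 * B₂ + 3 * B₂ ^ 2 - 3 * B₁ * B₃ := ⟨_, rfl⟩
  rw [← hN₀] at hC1
  rw [← hN₁] at hC2
  set N₂ := B₁ ^ 7 - B₁ ^ 6 * (8 * B₂ + 3)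
      - 6 * B₁ ^ 4 * (B₂ * (3 * B₂ + 2 * B₃ + 2) - 6 * B₃ + 9 * B₄)
      + B₁ ^ 5 * (7 * B₂ * (B₂ + 4) - 24 * B₃ + 18 * B₄)
      + 6 * B₁ ^ 3 * (B₂ ^ 3 - 2 * B₂ ^ 2 + 8 * B₂ * B₃ - 3 * B₃ ^ 2 + 6 * (B₂ + 1) * B₄)
      - 6 * B₁ * B₂ * (3 * B₂ ^ 3 - 6 * B₃ ^ 2 + B₂ ^ 2 * (4 * B₃ - 6)
          + 6 * B₂ * (B₄ - 2 * B₃))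
      + 18 * B₂ ^ 2 * (-2 * B₃ ^ 2 + B₂ * ((B₂ - 2) * B₂ + 2 * B₄))
      + B₁ ^ 2 * B₂ * (B₂ * (B₂ * (5 * B₂ + 6) - 24 * B₃ + 18 * B₄) - 36 * (2 * B₃ + B₄))
    with hN₂
  clear_value N₂
  have aux : ∀ {x y : ℝ}, |x| < |y| → y ≠ 0 ∧ |x / y| < 1 := fun {x y} h => by
    have hy : 0 < |y| := (abs_nonneg x).trans_lt h
    exact ⟨abs_pos.1 hy, by rwa [abs_div, div_lt_one hy]⟩
  obtain ⟨hy0, h0⟩ := aux hC1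
  obtain ⟨hy1, h1⟩ := aux hC2
  obtain ⟨hy2, h2⟩ := aux hC3
  have hB0 := hB.ne'
  have hd0 := right_ne_zero_of_mul hy0
  have hD0 := right_ne_zero_of_mul hy1
  have hR0 := right_ne_zero_of_mul hy2
  have hP0 := right_ne_zero_of_mul (left_ne_zero_of_mul hy2)
  have hu0 : u ≠ 0 := by
    rintro rfl
    simp at ha0
  have hs : √(d / (2 * u)) ^ 2 = d / (2 * u) := Real.sq_sqrt ha0.le
  have hs4 : √(d / (2 * u)) ^ 4 = (d / (2 * u)) ^ 2 := by
    rw [show 4 = 2 * 2 from rfl, pow_mul, hs]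
  -- The complementary quantities `1 - α₀²` and `1 - α₁²` factor.
  have hα₀ : 1 - (-(N₀ / (B₁ * d))) ^ 2 = -4 * D * u ^ 2 / (B₁ * d) ^ 2 := by
    field_simp
    rw [hN₀, hd, hD, hu]
    ring
  have hα₁ : 1 - (N₁ / (3 * D)) ^ 2 = B₁ * P * R / (9 * D ^ 2) := by
    field_simp
    rw [hN₁, hD, hP, hR]
    ring
  have hα₀₁ : (1 - (-(N₀ / (B₁ * d))) ^ 2) * (N₁ / (3 * D)) =
      -4 * u ^ 2 * N₁ / (3 * (B₁ * d) ^ 2) := by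
    rw [hα₀]
    field_simp
  have hα₂ : N₂ / (2 * d * P * R) * (1 - (N₁ / (3 * D)) ^ 2) = N₂ * B₁ / (18 * d * D ^ 2) := by
    rw [hα₁]
    field_simp
    ring
  refine ⟨√(d / (2 * u)), -(N₀ / (B₁ * d)), N₁ / (3 * D), N₂ / (2 * d * P * R), _, _,
    Real.sqrt_nonneg _, Real.sqrt_le_one.2 ha1.le, by rwa [abs_neg], h1, h2,
    rfl, rfl, ?_, ?_, ?_, ?_⟩
  · rw [hs]
    field_simp
    rw [hN₀, hd, hu]
    ring
  · rw [hs4]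
    field_simp
    rw [hN₀, hd, hu]
    ring
  · rw [hs, hs4, hα₀₁]
    field_simp
    rw [hN₀, hN₁, hd, hu]
    ring
  · rw [hs, hs4, hα₂, hα₀₁, hα₀]
    field_simp
    rw [hN₀, hN₁, hN₂, hd, hu, hD]
    ring

/-! ### The fifth coefficient in terms of the Schwarz function -/

theorem analyticAt_zero_of_differentiableOn {f : ℂ → ℂ} (hf : DifferentiableOn ℂ f unitDisk) :
    AnalyticAt ℂ f 0 :=
  hf.analyticAt (Metric.ball_mem_nhds 0 one_pos)

theorem two_mul_mul_deriv_eq {f : ℂ → ℂ} {z w : ℂ} (hne : z ≠ 0 → f z ≠ f (-z))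
    (h : symmetricQuotient f z = w) : 2 * z * deriv f z = (f z - f (-z)) * w := by
  rcases eq_or_ne z 0 with rfl | hz
  · simp
  · rw [← h, symmetricQuotient, if_neg hz, mul_div_cancel₀ _ (sub_ne_zero.2 (hne hz))]

/-- Comparing coefficients in `2 z f'(z) = (f(z) - f(-z)) φ(ω(z))`. -/
theorem four_mul_taylorCoeff_five {φ f ω : ℂ → ℂ} (hφ : DifferentiableOn ℂ φ unitDisk)
    (hφ0 : φ 0 = 1) (hf : IsNormalized f) (hω : IsSchwarz ω)
    (hne : ∀ z ∈ unitDisk, z ≠ 0 → f z ≠ f (-z))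
    (h : ∀ z ∈ unitDisk, symmetricQuotient f z = φ (ω z)) :
    4 * taylorCoeff f 5 = taylorCoeff φ 1 * taylorCoeff ω 4
      + 2 * taylorCoeff φ 2 * (taylorCoeff ω 1 * taylorCoeff ω 3)
      + (taylorCoeff φ 2 + taylorCoeff φ 1 ^ 2 / 2) * taylorCoeff ω 2 ^ 2
      + (3 * taylorCoeff φ 3 + taylorCoeff φ 1 * taylorCoeff φ 2)
        * (taylorCoeff ω 1 ^ 2 * taylorCoeff ω 2)
      + (taylorCoeff φ 4 + taylorCoeff φ 2 ^ 2 / 2) * taylorCoeff ω 1 ^ 4 := by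
  have hfa := analyticAt_zero_of_differentiableOn hf.holomorphic
  have hωa := analyticAt_zero_of_differentiableOn hω.holomorphic
  have hφa := analyticAt_zero_of_differentiableOn hφ
  have hfn : AnalyticAt ℂ (fun z => f (-z)) 0 :=
    AnalyticAt.fun_comp (by rwa [neg_zero]) analyticAt_id.fun_neg
  have hpa : AnalyticAt ℂ (fun z => φ (ω z)) 0 :=
    AnalyticAt.fun_comp (by rwa [hω.map_zero]) hωa
  have hid : AnalyticAt ℂ (fun z : ℂ => z) 0 := analyticAt_id
  have heq : (fun z => (2 * z) * deriv f z) =ᶠ[nhds 0] fun z => (f z - f (-z)) * φ (ω z) := by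
    filter_upwards [Metric.ball_mem_nhds (0 : ℂ) one_pos] with z hz
    exact two_mul_mul_deriv_eq (hne z hz) (h z hz)
  have hser := taylorSeries_congr heq
  rw [taylorSeries_mul (analyticAt_const.fun_mul hid) hfa.deriv,
    taylorSeries_mul analyticAt_const hid, taylorSeries_const, taylorSeries_id,
    taylorSeries_mul (hfa.fun_sub hfn) hpa, taylorSeries_sub hfa hfn] at hser
  set p := taylorSeries fun z => φ (ω z) with hp
  obtain ⟨v, hv⟩ := exists_taylorSeries_comp hωa hω.map_zero 5 hφa
  rw [← hp] at hv
  have f0 : taylorCoeff f 0 = 0 := by rw [taylorCoeff_zero, hf.map_zero]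
  have f1 : taylorCoeff f 1 = 1 := by rw [taylorCoeff_one, hf.deriv_zero]
  have c0 : taylorCoeff ω 0 = 0 := by rw [taylorCoeff_zero, hω.map_zero]
  have b0 : taylorCoeff φ 0 = 1 := by rw [taylorCoeff_zero, hφ0]
  simp only [Finset.sum_range_succ, Finset.sum_range_zero, zero_add, pow_succ, pow_zero,
    one_mul, mul_one] at hv
  have hC0 : ∀ c : ℂ, coeff 0 (C c) = c := fun c => by simp
  have hC2 : ∀ c : ℂ, coeff 2 (C c) = 0 := fun c => by simp
  have hC4 : ∀ c : ℂ, coeff 4 (C c) = 0 := fun c => by simp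
  have p0 : coeff 0 p = 1 := by
    rw [hv]
    simp only [map_add, coeff_C_mul, coeff_zero_mul_eq, coeff_taylorSeries, c0, b0, hC0]
    ring
  have p2 : coeff 2 p =
      taylorCoeff φ 1 * taylorCoeff ω 2 + taylorCoeff φ 2 * taylorCoeff ω 1 ^ 2 := by
    rw [hv]
    simp only [map_add, coeff_C_mul, coeff_zero_mul_eq, coeff_one_mul_eq, coeff_two_mul_eq,
      coeff_taylorSeries, c0, b0, hC2]
    ring
  have p4 : coeff 4 p = taylorCoeff φ 1 * taylorCoeff ω 4
      + taylorCoeff φ 2 * (2 * taylorCoeff ω 1 * taylorCoeff ω 3 + taylorCoeff ω 2 ^ 2)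
      + 3 * taylorCoeff φ 3 * (taylorCoeff ω 1 ^ 2 * taylorCoeff ω 2)
      + taylorCoeff φ 4 * taylorCoeff ω 1 ^ 4 := by
    rw [hv]
    simp only [map_add, coeff_C_mul, coeff_zero_mul_eq, coeff_one_mul_eq, coeff_two_mul_eq,
      coeff_three_mul_eq, coeff_four_mul_eq, coeff_taylorSeries, c0, b0, hC4]
    ring
  have h3 := congrArg (coeff 3) hser
  have h5 := congrArg (coeff 5) hser
  rw [mul_assoc, coeff_C_mul, coeff_succ_X_mul] at h3 h5
  simp only [coeff_three_mul_eq, coeff_five_mul_eq, map_sub, coeff_taylorSeries, taylorCoeff_deriv,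
    taylorCoeff_comp_neg, f0, f1, p0] at h3 h5
  norm_num at h3 h5
  rw [p2] at h3 h5
  rw [p4] at h5
  linear_combination (1 / 2 : ℂ) * h5 +
    (taylorCoeff φ 1 * taylorCoeff ω 2 + taylorCoeff φ 2 * taylorCoeff ω 1 ^ 2) / 4 * h3

theorem IsAdmissible.taylorCoeff_one_pos {φ : ℂ → ℂ} (hφ : IsAdmissible φ) {B₁ : ℝ}
    (hB₁ : taylorCoeff φ 1 = (B₁ : ℂ)) : 0 < B₁ := by
  have h := hφ.deriv_re_pos
  rwa [← taylorCoeff_one, hB₁, Complex.ofReal_re] at h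

/-- The coefficient bound: for the parameters of `exists_schur_parameters` the averaged Schur
functional of `ω` is `4 a₅ / B₁`. -/
theorem norm_taylorCoeff_five_le {φ f : ℂ → ℂ} (hφ : IsAdmissible φ) {B₁ B₂ B₃ B₄ : ℝ}
    (hB₁ : taylorCoeff φ 1 = (B₁ : ℂ)) (hB₂ : taylorCoeff φ 2 = (B₂ : ℂ))
    (hB₃ : taylorCoeff φ 3 = (B₃ : ℂ)) (hB₄ : taylorCoeff φ 4 = (B₄ : ℂ))
    (hC1 : ConditionC1 B₁ B₂) (hC2 : ConditionC2 B₁ B₂ B₃)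
    (hC3 : ConditionC3 B₁ B₂ B₃ B₄) (hC4 : ConditionC4 B₁ B₂)
    (hf : IsSymmetricStarlike φ f) : ‖taylorCoeff f 5‖ ≤ B₁ / 4 := by
  obtain ⟨ω, hω, hq⟩ := hf.subordinate
  have hB := hφ.taylorCoeff_one_pos hB₁
  have h5 := four_mul_taylorCoeff_five hφ.holomorphic hφ.map_zero hf.normalized hω hf.ne hq
  rw [hB₁, hB₂, hB₃, hB₄] at h5
  obtain ⟨s, α₀, α₁, α₂, E₂, E₃, hs0, hs1, h0, h1, h2, hE₂, hE₃, i1, i2, i3, i4⟩ :=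
    exists_schur_parameters hB hC1 hC2 hC3 hC4
  have hW : IsContractive (taylorSeries ω) := isContractive_taylorSeries hω.holomorphic
    fun z hz => by
      have := hω.mapsTo hz
      simp only [unitDisk, mem_ball_zero_iff] at this
      exact this.le
  have hW0 : constantCoeff (taylorSeries ω) = 0 := by simp [hω.map_zero]
  have hc : constantCoeff (1 - taylorSeries ω) ≠ 0 := by simp [hω.map_zero]
  have hx : taylorSeries ω * (1 - taylorSeries ω)⁻¹ * (1 - taylorSeries ω) = taylorSeries ω := by
    rw [mul_assoc, PowerSeries.inv_mul_cancel _ hc, mul_one]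
  have hle := hW.norm_averaged_functional_le hW0 hx hs0 hs1 h0 h1 h2 hE₂ hE₃
  obtain ⟨x1, x2, x3, x4⟩ := coeff_geometric hW0 hx
  rw [x1, x2, x3, x4] at hle
  simp only [coeff_taylorSeries] at hle
  replace i1 := congrArg Complex.ofReal i1
  replace i2 := congrArg Complex.ofReal i2
  replace i3 := congrArg Complex.ofReal i3
  replace i4 := congrArg Complex.ofReal i4
  push_cast at i1 i2 i3 i4
  obtain ⟨F, hFe, hF1⟩ : ∃ F : ℂ, F = _ ∧ ‖F‖ ≤ 1 := ⟨_, rfl, hle⟩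
  have hF : 4 * taylorCoeff f 5 = B₁ * F := by
    rw [h5, hFe]
    linear_combination -2 * taylorCoeff ω 1 * taylorCoeff ω 3 * i1 - taylorCoeff ω 2 ^ 2 * i2
      - taylorCoeff ω 1 ^ 2 * taylorCoeff ω 2 * i3 - taylorCoeff ω 1 ^ 4 * i4
  have hn := congrArg norm hF
  rw [norm_mul, norm_mul, Complex.norm_real, Real.norm_of_nonneg hB.le] at hn
  norm_num at hn
  nlinarith

/-! ### Sharpness -/

theorem isSchwarz_pow_four : IsSchwarz fun z => z ^ 4 where
  holomorphic := by fun_prop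
  mapsTo z hz := by
    simp only [unitDisk, mem_ball_zero_iff, norm_pow] at hz ⊢
    exact pow_lt_one₀ (norm_nonneg _) hz (by norm_num)
  map_zero := by norm_num

theorem isSymmetricStarlike_of_symmetricQuotient_eq {φ f : ℂ → ℂ} (hφ : IsAdmissible φ)
    (hf : IsNormalized f) (h : ∀ z ∈ unitDisk, symmetricQuotient f z = φ (z ^ 4)) :
    IsSymmetricStarlike φ f where
  normalized := hf
  ne z hz hz0 hfz := by
    -- A vanishing denominator would give the quotient the junk value `0`, but `Re φ > 0`.
    have h1 := h z hz
    rw [symmetricQuotient, if_neg hz0, hfz, sub_self, div_zero] at h1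
    have h2 := hφ.re_pos _ (isSchwarz_pow_four.mapsTo hz)
    simp only [← h1, Complex.zero_re, lt_self_iff_false] at h2
  subordinate := ⟨fun z => z ^ 4, isSchwarz_pow_four, h⟩

theorem taylorCoeff_pow_four (n : ℕ) : taylorCoeff (fun z => z ^ 4) n = if n = 4 then 1 else 0 := by
  have hid : AnalyticAt ℂ (fun z : ℂ => z) 0 := analyticAt_id
  rw [← coeff_taylorSeries, taylorSeries_pow hid, taylorSeries_id, coeff_X_pow]

theorem taylorCoeff_five_extremal {φ f : ℂ → ℂ} (hφ : IsAdmissible φ)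
    (hf : IsNormalized f) (h : ∀ z ∈ unitDisk, symmetricQuotient f z = φ (z ^ 4)) :
    4 * taylorCoeff f 5 = taylorCoeff φ 1 := by
  have h5 := four_mul_taylorCoeff_five hφ.holomorphic hφ.map_zero hf isSchwarz_pow_four
    (isSymmetricStarlike_of_symmetricQuotient_eq hφ hf h).ne h
  simpa [taylorCoeff_pow_four] using h5

/-- The extremal function is `f(z) = z exp g(z)`, where `g` is the primitive of
`(φ(z⁴) - 1) / z` with `g 0 = 0`. It is odd since `φ(z⁴)` is even, so that the equation reduces to
`z f'(z) = f(z) φ(z⁴)`. -/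
theorem exists_extremal {φ : ℂ → ℂ} (hφ : DifferentiableOn ℂ φ unitDisk) (hφ0 : φ 0 = 1) :
    ∃ f : ℂ → ℂ, IsNormalized f ∧ ∀ z ∈ unitDisk, symmetricQuotient f z = φ (z ^ 4) := by
  set p : ℂ → ℂ := fun z => φ (z ^ 4) with hp
  have hpd : DifferentiableOn ℂ p unitDisk :=
    hφ.comp isSchwarz_pow_four.holomorphic isSchwarz_pow_four.mapsTo
  have hp0 : p 0 = 1 := by simp [hp, hφ0]
  have hpe : ∀ z, p (-z) = p z := fun z => by
    simp only [hp, Even.neg_pow (show Even 4 by decide)]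
  have h0 : (0 : ℂ) ∈ unitDisk := by simp [unitDisk]
  have hnhds : ∀ z ∈ unitDisk, unitDisk ∈ nhds z := fun z hz => Metric.isOpen_ball.mem_nhds hz
  have hneg : ∀ z ∈ unitDisk, -z ∈ unitDisk := fun z hz => by simpa [unitDisk] using hz
  have hqd : DifferentiableOn ℂ (dslope p 0) unitDisk :=
    (Complex.differentiableOn_dslope (hnhds 0 h0)).2 hpd
  obtain ⟨g, hg0, hg⟩ := hqd.isExactOn_ball.with_val_at 0 0
  have hq : ∀ z, z * dslope p 0 z = p z - 1 := fun z => by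
    have := eq_add_mul_dslope p z
    rw [hp0] at this
    linear_combination -this
  have hqodd : ∀ z, dslope p 0 (-z) = -dslope p 0 z := by
    intro z
    rcases eq_or_ne z 0 with rfl | hz
    · have : deriv p 0 = -deriv p 0 := by
        have h1 := deriv_comp_neg p 0
        rw [neg_zero, funext hpe] at h1
        exact h1
      simpa using this
    · have h1 := hq z
      have h2 := hq (-z)
      rw [hpe] at h2
      refine mul_left_cancel₀ hz ?_
      linear_combination h1 - h2
  have hgeven : ∀ z ∈ unitDisk, g (-z) = g z := by
    have hd : ∀ z ∈ unitDisk, HasDerivAt (fun z => g (-z) - g z) 0 z := by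
      intro z hz
      have h1 := ((hg (-z) (hneg z hz)).comp z (hasDerivAt_neg z)).sub (hg z hz)
      rw [hqodd] at h1
      exact h1.congr_deriv (by ring)
    intro z hz
    have := Metric.isOpen_ball.is_const_of_deriv_eq_zero (𝕜 := ℂ) (f := fun z => g (-z) - g z)
      (convex_ball (0 : ℂ) 1).isPreconnected
      (fun w hw => (hd w hw).differentiableAt.differentiableWithinAt)
      (fun w hw => (hd w hw).deriv) hz h0
    simpa [sub_eq_zero] using this
  have hfd : ∀ z ∈ unitDisk,
      HasDerivAt (fun z => z * Complex.exp (g z)) (Complex.exp (g z) * p z) z := by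
    intro z hz
    have h1 := (hasDerivAt_id z).mul (hg z hz).cexp
    refine h1.congr_deriv ?_
    simp only [id]
    linear_combination Complex.exp (g z) * hq z
  refine ⟨fun z => z * Complex.exp (g z), ⟨fun z hz =>
    (hfd z hz).differentiableAt.differentiableWithinAt, by simp, ?_⟩, fun z hz => ?_⟩
  · rw [(hfd 0 h0).deriv, hp0, hg0]
    simp
  · rw [symmetricQuotient]
    split_ifs with hz0
    · simp [hz0, hφ0]
    · rw [(hfd z hz).deriv, hgeven z hz]
      have := Complex.exp_ne_zero (g z)
      simp only [hp]
      field_simp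
      ring

theorem theorem1 (φ : ℂ → ℂ) (hφ : IsAdmissible φ) (B₁ B₂ B₃ B₄ : ℝ)
    (hB₁ : taylorCoeff φ 1 = (B₁ : ℂ)) (hB₂ : taylorCoeff φ 2 = (B₂ : ℂ))
    (hB₃ : taylorCoeff φ 3 = (B₃ : ℂ)) (hB₄ : taylorCoeff φ 4 = (B₄ : ℂ))
    (hC1 : ConditionC1 B₁ B₂) (hC2 : ConditionC2 B₁ B₂ B₃)
    (hC3 : ConditionC3 B₁ B₂ B₃ B₄) (hC4 : ConditionC4 B₁ B₂) :
    (∀ f : ℂ → ℂ, IsSymmetricStarlike φ f → ‖taylorCoeff f 5‖ ≤ B₁ / 4) ∧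
    (∃ f : ℂ → ℂ, IsNormalized f ∧ ∀ z ∈ unitDisk, symmetricQuotient f z = φ (z ^ 4)) ∧
    (∀ f : ℂ → ℂ, IsNormalized f →
      (∀ z ∈ unitDisk, symmetricQuotient f z = φ (z ^ 4)) →
      IsSymmetricStarlike φ f ∧ ‖taylorCoeff f 5‖ = B₁ / 4) := by
  have hB := hφ.taylorCoeff_one_pos hB₁
  refine ⟨fun f hf => norm_taylorCoeff_five_le hφ hB₁ hB₂ hB₃ hB₄ hC1 hC2 hC3 hC4 hf,
    exists_extremal hφ.holomorphic hφ.map_zero, fun f hf h =>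
    ⟨isSymmetricStarlike_of_symmetricQuotient_eq hφ hf h, ?_⟩⟩
  have h5 := congrArg norm (taylorCoeff_five_extremal hφ hf h)
  rw [norm_mul, hB₁, Complex.norm_real, Real.norm_of_nonneg hB.le] at h5
  norm_num at h5
  linarith
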